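/- Let $\mathcal X=\{1,2,\dots\}$. For a probability distribution $P$ on $\mathcal X$ let $P^{\downarrow}(1)\ge P^{\downarrow}(2)\ge\cdots$ be its masses listed in decreasing order (with multiplicity, and continued by zeros if $P$ has only finitely many positive masses), and let $H(P)=-\sum_{x} P(x)\log P(x)\in[0,\infty]$ be its Shannon entropy (natural logarithm, $0\log 0=0$). A distribution $Q$ majorizes $P$ if $\sum_{i=1}^{k}P^{\downarrow}(i)\le\sum_{i=1}^{k}Q^{\downarrow}(i)$ for every $k\ge 1$. For a random variable $X$ with values in a countable set and a random variable $Y$ with values in a measurable space $\mathcal Y$, let $H(X\mid Y)=\mathbb E[H(P_{X|Y})]$, where $P_{X|Y}$ is the regular conditional distribution of $X$ given $Y$. If $X$ is $\mathcal X$-valued and $L\ge 1$ is an integer, let $$P_{\mathrm e}^{(L)}(X\mid Y)=\inf_{f}\ \mathbb P\{X\notin f(Y)\},$$ where $f$ ranges over all measurable maps that assign to each $y\in\mathcal Y$ a nonempty subset $f(y)\subset\mathcal X$ with at most $L$ elements. Let $\{L_n\}_{n\ge1}$ be a sequence of positive integers, $\{\mathcal Y_n\}_{n\ge1}$ a sequence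 of measurable spaces, and $\{(X_n,Y_n)\}_{n\ge1}$ a sequence of random variables on a common probability space, where $(X_n,Y_n)$ is $\mathcal X\times\mathcal Y_n$-valued and $H(P_{X_n})<\infty$ for every $n\ge1$. (No independence is assumed.) Write $X^n=(X_1,\dots,X_n)$ and $Y^n=(Y_1,\dots,Y_n)$. Let $P_X$ be a probability distribution on $\mathcal X$ with $H(P_X)<\infty$. **Theorem.** Suppose that $P_{X_n}$ majorizes $P_X$ for all sufficiently large $n$. If $$\lim_{n\to\infty}\frac1n\sum_{i=1}^{n}P_{\mathrm e}^{(L_n)}(X_i\mid Y_i)=0,$$ then $$\limsup_{n\to\infty}\frac1n H(X^n\mid Y^n)\ \le\ \limsup_{n\to\infty}\log L_n ,$$ where both sides are elements of $[0,\infty]$. -/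

import Mathlib

open MeasureTheory ProbabilityTheory Filter Topology
open scoped ENNReal

/-! The source alphabet is `ℕ`, i.e. the countably infinite alphabet `{1, 2, …}` with its letters
relabelled by `x ↦ x - 1`. A distribution on the alphabet is a probability measure on `ℕ`. -/

/-- The decreasing rearrangement of a distribution `P` on `ℕ`: `decRearr P k` is the
`(k+1)`-st largest probability mass of `P`, counted with multiplicity; in the usual form,
`P↓ (k) = inf {t ≥ 0 : at most k letters have mass exceeding t}`. -/
noncomputable def decRearr (P : Measure ℕ) (k : ℕ) : ℝ≥0∞ :=
  sInf {t : ℝ≥0∞ | {x : ℕ | t < P {x}}.encard ≤ k}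

/-- `Majorizes Q P`: the distribution `Q` majorizes the distribution `P`. -/
def Majorizes (Q P : Measure ℕ) : Prop :=
  ∀ k : ℕ, ∑ i ∈ Finset.range k, decRearr P i ≤ ∑ i ∈ Finset.range k, decRearr Q i

/-- Shannon entropy (natural logarithm, with `0 log 0 = 0`) of a distribution on a countable
alphabet, with values in `[0, ∞]`. -/
noncomputable def shannonEntropy {α : Type*} [Countable α] [MeasurableSpace α] (P : Measure α) : ℝ≥0∞ :=
  ∑' x : α, ENNReal.ofReal (Real.negMulLog (P.real {x}))

/-- Conditional Shannon entropy `H(X | Y) = 𝔼[H(P_{X|Y})]`, where `P_{X|Y}` is the regular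
conditional distribution of `X` given `Y`. -/
noncomputable def condShannonEntropy {Ω α β : Type*} [MeasurableSpace Ω]
    [Countable α] [MeasurableSpace α] [StandardBorelSpace α] [Nonempty α] [MeasurableSpace β]
    (X : Ω → α) (Y : Ω → β) (μ : Measure Ω) [IsFiniteMeasure μ] : ℝ≥0∞ :=
  ∫⁻ ω, shannonEntropy (condDistrib X Y μ (Y ω)) ∂μ

/-- A list decoder with list size `L`: a measurable map that assigns to each observation `y`
a nonempty list of at most `L` letters. -/
structure ListDecoder (β : Type*) [MeasurableSpace β] (L : ℕ) where
  /-- the list of candidates -/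
  toFun : β → Finset ℕ
  nonempty : ∀ y, (toFun y).Nonempty
  card_le : ∀ y, (toFun y).card ≤ L
  measurableSet_mem : ∀ x, MeasurableSet {y | x ∈ toFun y}

/-- The minimum average probability of error under list decoding, `P_e^{(L)}(X | Y)`. -/
noncomputable def listError {Ω β : Type*} [MeasurableSpace Ω] [MeasurableSpace β]
    (L : ℕ) (X : Ω → ℕ) (Y : Ω → β) (μ : Measure Ω) : ℝ≥0∞ :=
  ⨅ f : ListDecoder β L, μ {ω | X ω ∉ f.toFun (Y ω)}

/-- The block `(Z_1, …, Z_n)`, where `Z i` stands for `Z_{i+1}`. -/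
def block {Ω : Type*} {β : ℕ → Type*} (Z : (i : ℕ) → Ω → β i) (n : ℕ) :
    Ω → ((i : Fin n) → β i) :=
  fun ω i => Z i ω

/-- The minimum arithmetic-mean probability of symbol-wise list decoding error
`(1/n) ∑_{i=1}^n P_e^{(L_n)}(X_i | Y_i)`, where `X i`, `Y i` stand for `X_{i+1}`, `Y_{i+1}`
and `L n` is the list size used for blocks of length `n`. -/
noncomputable def symbolwiseListError {Ω : Type*} [MeasurableSpace Ω] {β : ℕ → Type*}
    [∀ i, MeasurableSpace (β i)] (L : ℕ → ℕ) (X : ℕ → Ω → ℕ) (Y : (i : ℕ) → Ω → β i)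
    (μ : Measure Ω) (n : ℕ) : ℝ≥0∞ :=
  (∑ i ∈ Finset.range n, listError (L n) (X i) (Y i) μ) / (n : ℝ≥0∞)

/-! ### Self-information -/

/-! Every entropy bound comes from Gibbs' inequality with a well-chosen reference kernel
(`condShannonEntropy_le`). The product of the letterwise conditional laws reduces the block to
single letters, whatever their dependence (`condShannonEntropy_block_le_sum`). For one letter with
law Q, the reference puts weight exp(-η), spread evenly, on the decoder's list. The rest of the
weight gives the k-th likeliest letter of Q the k-th largest mass of P (`rerank`). The list costs
log L + η. Off the list, self-information up to M is charged to the error event and the excess to a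
tail. Since -log P↓(k) increases in k, majorization bounds this tail by that of P itself
(`Majorizes.tsum_selfInfo_rerank_le`), uniformly over letters, and it vanishes as M → ∞ because H(P)
is finite. The resulting bound (`condShannonEntropy_le_listError`) is affine in the error with a
fixed slope, so it can be averaged over letters; the finitely many letters without majorization
contribute O(1/n). -/

/-- The self-information `-log t` of a probability `t`, with value `∞` at `t = 0`. -/
noncomputable def selfInfo (t : ℝ≥0∞) : ℝ≥0∞ :=
  if t = 0 then ∞ else ENNReal.ofReal (-Real.log t.toReal)

@[simp] lemma selfInfo_zero : selfInfo 0 = ∞ := by simp [selfInfo]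

@[simp] lemma selfInfo_one : selfInfo 1 = 0 := by simp [selfInfo]

lemma selfInfo_of_ne_zero {t : ℝ≥0∞} (ht : t ≠ 0) :
    selfInfo t = ENNReal.ofReal (-Real.log t.toReal) := by simp [selfInfo, ht]

lemma measurable_selfInfo : Measurable selfInfo := by
  unfold selfInfo
  refine Measurable.ite (measurableSet_singleton 0) measurable_const ?_
  fun_prop

lemma selfInfo_anti {s t : ℝ≥0∞} (hst : s ≤ t) (ht : t ≠ ∞) : selfInfo t ≤ selfInfo s := by
  rcases eq_or_ne s 0 with rfl | hs
  · simp
  have ht0 : t ≠ 0 := fun h => hs (le_zero_iff.mp (h ▸ hst))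
  rw [selfInfo_of_ne_zero hs, selfInfo_of_ne_zero ht0]
  refine ENNReal.ofReal_le_ofReal (neg_le_neg (Real.log_le_log ?_ ?_))
  · exact ENNReal.toReal_pos hs (ne_top_of_le_ne_top ht hst)
  · exact ENNReal.toReal_mono ht hst

/-- Equality can fail only because `ENNReal.ofReal` truncates negative values, as may happen when a
factor exceeds 1. -/
lemma selfInfo_mul_le (s t : ℝ≥0∞) : selfInfo (s * t) ≤ selfInfo s + selfInfo t := by
  rcases eq_or_ne s 0 with rfl | hs
  · simp
  rcases eq_or_ne t 0 with rfl | ht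
  · simp
  rcases eq_or_ne s ∞ with rfl | hs'
  · simp [ENNReal.top_mul ht, selfInfo]
  rcases eq_or_ne t ∞ with rfl | ht'
  · simp [ENNReal.mul_top hs, selfInfo]
  rw [selfInfo_of_ne_zero hs, selfInfo_of_ne_zero ht, selfInfo_of_ne_zero (mul_ne_zero hs ht),
    ENNReal.toReal_mul, Real.log_mul (ENNReal.toReal_pos hs hs').ne' (ENNReal.toReal_pos ht ht').ne',
    neg_add]
  exact ENNReal.ofReal_add_le

lemma selfInfo_prod_le {ι : Type*} (s : Finset ι) (f : ι → ℝ≥0∞) :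
    selfInfo (∏ i ∈ s, f i) ≤ ∑ i ∈ s, selfInfo (f i) := by
  classical
  induction s using Finset.induction_on with
  | empty => simp
  | insert a s ha ih =>
    rw [Finset.prod_insert ha, Finset.sum_insert ha]
    exact (selfInfo_mul_le _ _).trans (by gcongr)

lemma ofReal_negMulLog_toReal {p : ℝ≥0∞} (hp : p ≠ ∞) :
    ENNReal.ofReal (Real.negMulLog p.toReal) = p * selfInfo p := by
  rcases eq_or_ne p 0 with rfl | h0
  · simp
  rw [selfInfo_of_ne_zero h0, Real.negMulLog, neg_mul_comm, ENNReal.ofReal_mul ENNReal.toReal_nonneg,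
    ENNReal.ofReal_toReal hp]

/-- This is log(q/p) ≤ q/p - 1 multiplied by p, arranged without subtraction; the linear terms
cancel after summation. -/
lemma mul_selfInfo_add_le {p q : ℝ≥0∞} (hp : p ≤ 1) (hq : q ≤ 1) :
    p * selfInfo p + p ≤ p * selfInfo q + q := by
  rcases eq_or_ne p 0 with rfl | hp0
  · simp
  rcases eq_or_ne q 0 with rfl | hq0
  · simp [ENNReal.mul_top hp0]
  have hp' : p ≠ ∞ := ne_top_of_le_ne_top ENNReal.one_ne_top hp
  have hq' : q ≠ ∞ := ne_top_of_le_ne_top ENNReal.one_ne_top hq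
  have ha := ENNReal.toReal_pos hp0 hp'
  have hb := ENNReal.toReal_pos hq0 hq'
  have ha1 : p.toReal ≤ 1 := ENNReal.toReal_le_of_le_ofReal zero_le_one (by simpa using hp)
  have hb1 : q.toReal ≤ 1 := ENNReal.toReal_le_of_le_ofReal zero_le_one (by simpa using hq)
  rw [selfInfo_of_ne_zero hp0, selfInfo_of_ne_zero hq0]
  rw [← ENNReal.ofReal_toReal hp', ← ENNReal.ofReal_toReal hq']
  generalize p.toReal = a at *
  generalize q.toReal = b at *
  have hla := Real.log_nonpos ha.le ha1
  have hlb := Real.log_nonpos hb.le hb1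
  rw [ENNReal.toReal_ofReal ha.le, ENNReal.toReal_ofReal hb.le,
    ← ENNReal.ofReal_mul ha.le, ← ENNReal.ofReal_mul ha.le, ← ENNReal.ofReal_add _ ha.le,
    ← ENNReal.ofReal_add _ hb.le]
  · refine ENNReal.ofReal_le_ofReal ?_
    have h := Real.log_le_sub_one_of_pos (div_pos hb ha)
    rw [Real.log_div hb.ne' ha.ne'] at h
    have h2 := mul_le_mul_of_nonneg_left h ha.le
    have h3 : a * (b / a - 1) = b - a := by field_simp
    rw [h3] at h2
    linarith
  · exact mul_nonneg ha.le (by linarith)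
  · exact mul_nonneg ha.le (by linarith)

/-! ### Gibbs' inequality -/

section Gibbs

variable {α : Type*} [Countable α] [MeasurableSpace α]

lemma shannonEntropy_eq_tsum (P : Measure α) [IsFiniteMeasure P] :
    shannonEntropy P = ∑' x, P {x} * selfInfo (P {x}) := by
  refine tsum_congr fun x => ?_
  exact ofReal_negMulLog_toReal (measure_ne_top P _)

lemma tsum_measure_singleton [MeasurableSingletonClass α] (P : Measure α) :
    ∑' x, P {x} = P Set.univ := by
  have := Measure.tsum_indicator_apply_singleton P Set.univ MeasurableSet.univ
  simpa using this

lemma shannonEntropy_le_tsum [MeasurableSingletonClass α] (P : Measure α) [IsProbabilityMeasure P]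
    {q : α → ℝ≥0∞} (hq : ∑' x, q x ≤ 1) :
    shannonEntropy P ≤ ∑' x, P {x} * selfInfo (q x) := by
  have h1 : ∑' x, P {x} = 1 := by rw [tsum_measure_singleton, measure_univ]
  have key : shannonEntropy P + 1 ≤ (∑' x, P {x} * selfInfo (q x)) + 1 := by
    rw [shannonEntropy_eq_tsum]
    nth_rw 1 [← h1]
    rw [← ENNReal.tsum_add]
    calc _ ≤ ∑' x, (P {x} * selfInfo (q x) + q x) :=
          ENNReal.tsum_le_tsum fun x =>
            mul_selfInfo_add_le prob_le_one ((ENNReal.le_tsum x).trans hq)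
      _ ≤ _ := by rw [ENNReal.tsum_add]; gcongr
  exact (ENNReal.add_le_add_iff_right ENNReal.one_ne_top).mp key

end Gibbs

/-! ### Conditional entropy -/

lemma lintegral_comp_eq_tsum {Ω α : Type*} [MeasurableSpace Ω] [Countable α] [MeasurableSpace α]
    [MeasurableSingletonClass α] {X : Ω → α} {μ : Measure Ω} (hX : Measurable X) (F : α → ℝ≥0∞) :
    ∫⁻ ω, F (X ω) ∂μ = ∑' x, μ.map X {x} * F x := by
  rw [← lintegral_map (measurable_of_countable F) hX, lintegral_countable']
  exact tsum_congr fun x => mul_comm _ _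

section Conditional

variable {Ω α β : Type*} [MeasurableSpace Ω] [Countable α] [MeasurableSpace α]
  [StandardBorelSpace α] [Nonempty α] [MeasurableSpace β]
  {X : Ω → α} {Y : Ω → β} {μ : Measure Ω} [IsProbabilityMeasure μ]

lemma lintegral_tsum_condDistrib (hX : Measurable X) (hY : Measurable Y) {F : β × α → ℝ≥0∞}
    (hF : Measurable F) :
    ∫⁻ ω, ∑' x, condDistrib X Y μ (Y ω) {x} * F (Y ω, x) ∂μ = ∫⁻ ω, F (Y ω, X ω) ∂μ := by
  have h1 : ∫⁻ ω, F (Y ω, X ω) ∂μ = ∫⁻ z, F z ∂(μ.map Y ⊗ₘ condDistrib X Y μ) := by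
    rw [compProd_map_condDistrib hX.aemeasurable, lintegral_map hF (hY.prodMk hX)]
  rw [h1, Measure.lintegral_compProd hF, lintegral_map hF.lintegral_kernel_prod_right' hY]
  refine lintegral_congr fun ω => ?_
  rw [lintegral_countable']
  exact tsum_congr fun x => mul_comm _ _

lemma condShannonEntropy_le (hX : Measurable X) (hY : Measurable Y) {q : β × α → ℝ≥0∞}
    (hq : Measurable q) (hq1 : ∀ y, ∑' x, q (y, x) ≤ 1) :
    condShannonEntropy X Y μ ≤ ∫⁻ ω, selfInfo (q (Y ω, X ω)) ∂μ := by
  refine le_of_le_of_eq ?_ (lintegral_tsum_condDistrib hX hY (measurable_selfInfo.comp hq))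
  exact lintegral_mono fun ω => shannonEntropy_le_tsum _ (hq1 _)

lemma measurable_condDistrib_singleton :
    Measurable fun z : β × α => condDistrib X Y μ z.1 {z.2} :=
  measurable_from_prod_countable_left fun _ =>
    Kernel.measurable_coe _ (measurableSet_singleton _)

lemma condShannonEntropy_eq (hX : Measurable X) (hY : Measurable Y) :
    condShannonEntropy X Y μ = ∫⁻ ω, selfInfo (condDistrib X Y μ (Y ω) {X ω}) ∂μ := by
  refine Eq.trans ?_ (lintegral_tsum_condDistrib hX hY
    (measurable_selfInfo.comp measurable_condDistrib_singleton))
  exact lintegral_congr fun ω => shannonEntropy_eq_tsum _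

lemma condShannonEntropy_le_shannonEntropy (hX : Measurable X) (hY : Measurable Y) :
    condShannonEntropy X Y μ ≤ shannonEntropy (μ.map X) := by
  have := Measure.isProbabilityMeasure_map (μ := μ) hX.aemeasurable
  refine (condShannonEntropy_le hX hY (q := fun z => μ.map X {z.2})
    ((measurable_of_countable fun x : α => μ.map X {x}).comp measurable_snd)
    fun y => ?_).trans_eq ?_
  · rw [tsum_measure_singleton, measure_univ]
  · rw [lintegral_comp_eq_tsum hX fun x => selfInfo (μ.map X {x}), shannonEntropy_eq_tsum]

lemma measurable_block {γ : ℕ → Type*} [∀ i, MeasurableSpace (γ i)] {Z : (i : ℕ) → Ω → γ i}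
    (hZ : ∀ i, Measurable (Z i)) (n : ℕ) : Measurable (block Z n) :=
  measurable_pi_lambda _ fun i => hZ i

end Conditional

lemma condShannonEntropy_block_le_sum {Ω : Type*} [MeasurableSpace Ω] {μ : Measure Ω}
    [IsProbabilityMeasure μ] {γ : ℕ → Type*} [∀ i, MeasurableSpace (γ i)]
    {X : ℕ → Ω → ℕ} (hX : ∀ i, Measurable (X i))
    {Y : (i : ℕ) → Ω → γ i} (hY : ∀ i, Measurable (Y i)) (n : ℕ) :
    condShannonEntropy (block X n) (block Y n) μ
      ≤ ∑ i ∈ Finset.range n, condShannonEntropy (X i) (Y i) μ := by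
  -- Reference kernel that treats the letters as independent, each given its own observation.
  let q : ((i : Fin n) → γ i) × (Fin n → ℕ) → ℝ≥0∞ := fun z =>
    ∏ i : Fin n, condDistrib (X i) (Y i) μ (z.1 i) {z.2 i}
  have hm : ∀ i : Fin n, Measurable fun z : ((i : Fin n) → γ i) × (Fin n → ℕ) =>
      condDistrib (X i) (Y i) μ (z.1 i) {z.2 i} := fun i =>
    measurable_condDistrib_singleton.comp
      (((measurable_pi_apply i).comp measurable_fst).prodMk
        ((measurable_pi_apply i).comp measurable_snd))
  have hq : Measurable q := Finset.measurable_fun_prod _ fun i _ => hm i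
  have hq1 : ∀ y, ∑' x, q (y, x) ≤ 1 := by
    intro y
    have : ∀ x, q (y, x) = Measure.pi (fun i : Fin n => condDistrib (X i) (Y i) μ (y i)) {x} :=
      fun x => (Measure.pi_singleton _ _).symm
    simp_rw [this]
    rw [tsum_measure_singleton]
    exact prob_le_one
  refine (condShannonEntropy_le (measurable_block hX n) (measurable_block hY n) hq hq1).trans ?_
  rw [← Fin.sum_univ_eq_sum_range (fun i => condShannonEntropy (X i) (Y i) μ)]
  simp_rw [fun i => condShannonEntropy_eq (μ := μ) (hX i) (hY i)]
  rw [← lintegral_finsetSum]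
  · exact lintegral_mono fun ω => selfInfo_prod_le _ _
  · intro i _
    exact measurable_selfInfo.comp (measurable_condDistrib_singleton.comp ((hY i).prodMk (hX i)))

/-! ### The decreasing rearrangement -/

/-- The letters preceding `x` when letters are listed by decreasing mass, ties being broken
by the order of `ℕ`. -/
def massPred (P : Measure ℕ) (x : ℕ) : Set ℕ := {z | P {x} < P {z} ∨ (P {z} = P {x} ∧ z < x)}

/-- The position of `x` when letters are listed by decreasing mass. -/
noncomputable def massRank (P : Measure ℕ) (x : ℕ) : ℕ := (massPred P x).ncard

section Rearrangement

variable {P : Measure ℕ}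

lemma finite_setOf_le_measure_singleton [IsFiniteMeasure P] {t : ℝ≥0∞} (ht : t ≠ 0) :
    {z : ℕ | t ≤ P {z}}.Finite := by
  refine ENNReal.finite_const_le_of_tsum_ne_top ?_ ht
  rw [tsum_measure_singleton]
  exact measure_ne_top P _

lemma massPred_subset (x : ℕ) : massPred P x ⊆ {z | P {x} ≤ P {z}} := by
  rintro z (h | h)
  · exact h.le
  · exact h.1.ge

lemma finite_massPred [IsFiniteMeasure P] {x : ℕ} (hx : P {x} ≠ 0) : (massPred P x).Finite :=
  (finite_setOf_le_measure_singleton hx).subset (massPred_subset x)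

lemma notMem_massPred_self (x : ℕ) : x ∉ massPred P x := by simp [massPred]

lemma massPred_trans {x y z : ℕ} (hxy : x ∈ massPred P y) (hyz : y ∈ massPred P z) :
    x ∈ massPred P z := by
  rcases hxy with h | ⟨h, h'⟩ <;> rcases hyz with k | ⟨k, k'⟩
  · exact Or.inl (k.trans h)
  · exact Or.inl (k ▸ h)
  · exact Or.inl (h ▸ k)
  · exact Or.inr ⟨h.trans k, h'.trans k'⟩

lemma massPred_trichotomy (x y : ℕ) : x ∈ massPred P y ∨ x = y ∨ y ∈ massPred P x := by
  rcases lt_trichotomy (P {x}) (P {y}) with h | h | h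
  · exact Or.inr (Or.inr (Or.inl h))
  · rcases lt_trichotomy x y with k | k | k
    · exact Or.inl (Or.inr ⟨h, k⟩)
    · exact Or.inr (Or.inl k)
    · exact Or.inr (Or.inr (Or.inr ⟨h.symm, k⟩))
  · exact Or.inl (Or.inl h)

lemma massRank_lt [IsFiniteMeasure P] {x y : ℕ} (hy : P {y} ≠ 0) (hxy : x ∈ massPred P y) :
    massRank P x < massRank P y :=
  Set.ncard_lt_ncard ⟨fun _ hz => massPred_trans hz hxy,
    fun h => notMem_massPred_self x (h hxy)⟩ (finite_massPred hy)

/-- A null letter may have infinitely many predecessors, and `ncard` then returns 0; hence the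
restriction to positive masses. -/
lemma injOn_massRank [IsFiniteMeasure P] : Set.InjOn (massRank P) {x | P {x} ≠ 0} := by
  intro x hx y hy hxy
  rcases massPred_trichotomy (P := P) x y with h | h | h
  · exact absurd hxy (massRank_lt hy h).ne
  · exact h
  · exact absurd hxy (massRank_lt hx h).ne'

lemma decRearr_antitone (P : Measure ℕ) : Antitone (decRearr P) := by
  intro j k hjk
  refine sInf_le_sInf fun t ht => le_trans (α := ℕ∞) ht ?_
  exact_mod_cast hjk

lemma decRearr_le {k : ℕ} {t : ℝ≥0∞} (h : {x : ℕ | t < P {x}}.encard ≤ k) : decRearr P k ≤ t :=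
  sInf_le h

lemma decRearr_massRank [IsFiniteMeasure P] {x : ℕ} (hx : P {x} ≠ 0) :
    decRearr P (massRank P x) = P {x} := by
  refine le_antisymm (decRearr_le ?_) (le_sInf fun t ht => ?_)
  · rw [massRank, (finite_massPred hx).cast_ncard_eq]
    exact Set.encard_le_encard fun z hz => Or.inl hz
  · by_contra! hlt
    have hsub : insert x (massPred P x) ⊆ {z : ℕ | t < P {z}} := by
      intro z hz
      rcases Set.mem_insert_iff.mp hz with rfl | hz
      · exact hlt
      · exact lt_of_lt_of_le hlt (massPred_subset x hz)
    have h1 := (Set.encard_le_encard hsub).trans ht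
    rw [Set.encard_insert_of_notMem (notMem_massPred_self x),
      ← (finite_massPred hx).cast_ncard_eq, massRank] at h1
    have h2 : (massPred P x).ncard + 1 ≤ (massPred P x).ncard := by exact_mod_cast h1
    omega

/-- Only finitely many masses lie in [t/2, t), so some s < t bounds them all. If at most k letters
had mass at least t, this s would compete in the infimum defining t. -/
lemma lt_ncard_setOf_decRearr_le [IsFiniteMeasure P] {k : ℕ} (hk : decRearr P k ≠ 0) :
    k < {z : ℕ | decRearr P k ≤ P {z}}.ncard := by
  set t := decRearr P k with ht
  by_contra! hle
  have hfin := finite_setOf_le_measure_singleton (P := P) hk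
  have ht' : t ≠ ∞ := by
    refine ne_top_of_le_ne_top (measure_ne_top P Set.univ) (decRearr_le ?_)
    have : {x : ℕ | P Set.univ < P {x}} = ∅ := by
      ext x
      simpa using measure_mono (Set.subset_univ _)
    simp [this]
  have hhalf : t / 2 ≠ 0 := (ENNReal.half_pos hk).ne'
  let S : Set ℕ := {z : ℕ | t / 2 ≤ P {z}} \ {z : ℕ | t ≤ P {z}}
  have hS : S.Finite := (finite_setOf_le_measure_singleton hhalf).subset Set.sdiff_subset
  let s : ℝ≥0∞ := (t / 2) ⊔ hS.toFinset.sup fun z => P {z}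
  have hs : s < t := by
    refine max_lt (ENNReal.half_lt_self hk ht') ?_
    rw [Finset.sup_lt_iff (pos_iff_ne_zero.mpr hk)]
    intro z hz
    have : z ∈ S := by simpa using hz
    simpa using this.2
  have hsub : {z : ℕ | s < P {z}} ⊆ {z : ℕ | t ≤ P {z}} := by
    intro z hz
    by_contra hz'
    have hzS : z ∈ S := ⟨(lt_of_le_of_lt (le_max_left (t / 2) _) hz).le, hz'⟩
    have h1 : P {z} ≤ hS.toFinset.sup fun z => P {z} :=
      Finset.le_sup (f := fun z => P {z}) (by simpa using hzS)
    exact absurd hz (not_lt.mpr (h1.trans (le_max_right _ _)))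
  refine absurd (decRearr_le (P := P) (k := k) (t := s) ?_) (not_le.mpr hs)
  refine (Set.encard_le_encard hsub).trans ?_
  rw [← hfin.cast_ncard_eq]
  exact_mod_cast hle

/-- Pigeonhole: ranks map the letters of mass at least `decRearr P k` injectively into an initial
segment of the same size, hence onto it, and that segment contains k. -/
lemma exists_massRank_eq [IsFiniteMeasure P] {k : ℕ} (hk : decRearr P k ≠ 0) :
    ∃ x, P {x} ≠ 0 ∧ massRank P x = k := by
  set t := decRearr P k with ht
  have hfin := finite_setOf_le_measure_singleton (P := P) hk
  have hne : ∀ {x}, x ∈ hfin.toFinset → P {x} ≠ 0 := fun hx h0 => by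
    have : t ≤ 0 := by simpa [h0] using hx
    exact hk (le_zero_iff.mp this)
  have hcard : hfin.toFinset.card = {z : ℕ | t ≤ P {z}}.ncard :=
    (Set.ncard_eq_toFinset_card _ hfin).symm
  have hmaps : ∀ x ∈ hfin.toFinset, massRank P x ∈ Finset.range hfin.toFinset.card := by
    intro x hx
    rw [Finset.mem_range, hcard]
    have hx' : t ≤ P {x} := by simpa using hx
    refine Set.ncard_lt_ncard ⟨fun z hz => hx'.trans (massPred_subset x hz), fun h => ?_⟩ hfin
    exact notMem_massPred_self x (h hx')
  obtain ⟨x, hx, hxk⟩ := Finset.surj_on_of_inj_on_of_card_le (fun x _ => massRank P x) hmaps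
    (fun x y hx hy h => injOn_massRank (hne hx) (hne hy) h) (by simp) k
    (by rw [Finset.mem_range, hcard]; exact lt_ncard_setOf_decRearr_le hk)
  exact ⟨x, hne hx, hxk.symm⟩

lemma tsum_decRearr [IsFiniteMeasure P] {φ : ℝ≥0∞ → ℝ≥0∞} (hφ : φ 0 = 0) :
    ∑' k, φ (decRearr P k) = ∑' x, φ (P {x}) := by
  have hne : ∀ {t}, φ t ≠ 0 → t ≠ 0 := fun h h0 => h (h0 ▸ hφ)
  refine tsum_eq_tsum_of_ne_zero_bij (fun x => massRank P x) ?_ ?_ ?_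
  · intro x y hxy
    exact Subtype.ext (injOn_massRank (hne x.2) (hne y.2) hxy)
  · intro k hk
    obtain ⟨x, hx, rfl⟩ := exists_massRank_eq (hne hk)
    refine ⟨⟨x, ?_⟩, rfl⟩
    rw [Function.mem_support, decRearr_massRank hx] at hk
    exact hk
  · intro x
    simp only [decRearr_massRank (hne x.2)]

lemma tsum_decRearr_eq_one [IsProbabilityMeasure P] : ∑' k, decRearr P k = 1 := by
  have h := tsum_decRearr (P := P) (φ := id) rfl
  simpa [tsum_measure_singleton] using h

lemma tsum_mul_comp_massRank_le [IsFiniteMeasure P] (g : ℕ → ℝ≥0∞) :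
    ∑' x, P {x} * g (massRank P x) ≤ ∑' k, decRearr P k * g k := by
  let S : Set ℕ := {x | P {x} ≠ 0}
  have h1 : ∑' x, P {x} * g (massRank P x) = ∑' x : S, P {x.1} * g (massRank P x) := by
    refine (tsum_subtype_eq_of_support_subset fun x hx => ?_).symm
    exact left_ne_zero_of_mul hx
  rw [h1]
  have hinj : Function.Injective fun x : S => massRank P x :=
    fun x y h => Subtype.ext (injOn_massRank x.2 y.2 h)
  refine le_trans (le_of_eq ?_)
    (ENNReal.tsum_comp_le_tsum_of_injective hinj fun k => decRearr P k * g k)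
  exact tsum_congr fun x => by rw [decRearr_massRank x.2]

end Rearrangement

/-! ### Majorization -/

lemma exists_eq_sum_range_of_monotone {g : ℕ → ℝ≥0∞} (hg : Monotone g) :
    ∃ d : ℕ → ℝ≥0∞, ∀ k, g k = ∑ m ∈ Finset.range (k + 1), d m := by
  refine ⟨fun m => Nat.casesOn m (g 0) fun j => g (j + 1) - g j, fun k => ?_⟩
  induction k with
  | zero => simp
  | succ k ih =>
    rw [Finset.sum_range_succ, ← ih]
    exact (add_tsub_cancel_of_le (hg k.le_succ)).symm

lemma tsum_mul_sum_range (a d : ℕ → ℝ≥0∞) :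
    ∑' k, a k * ∑ m ∈ Finset.range (k + 1), d m = ∑' m, d m * ∑' k, a (k + m) := by
  have h1 : ∀ k, a k * ∑ m ∈ Finset.range (k + 1), d m = ∑' m, if m ≤ k then d m * a k else 0 := by
    intro k
    rw [tsum_eq_sum (s := Finset.range (k + 1)), Finset.mul_sum]
    · refine Finset.sum_congr rfl fun m hm => ?_
      rw [if_pos (Nat.lt_succ_iff.mp (Finset.mem_range.mp hm)), mul_comm]
    · intro m hm
      rw [if_neg]
      simpa [Nat.lt_succ_iff] using hm
  simp_rw [h1]
  rw [ENNReal.tsum_comm]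
  refine tsum_congr fun m => ?_
  rw [← ENNReal.summable.sum_add_tsum_nat_add' (k := m), ← ENNReal.tsum_mul_left,
    Finset.sum_eq_zero, zero_add]
  · exact tsum_congr fun k => by simp
  · intro k hk
    rw [if_neg (not_le.mpr (Finset.mem_range.mp hk))]

/-- Abel summation: a monotone weight is a nonnegative combination of indicators of {k ≥ m}, so
comparing tails suffices. Infinite weights are allowed. -/
lemma tsum_mul_le_tsum_mul_of_monotone {a b g : ℕ → ℝ≥0∞} (hg : Monotone g)
    (hab : ∀ m, ∑' k, a (k + m) ≤ ∑' k, b (k + m)) :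
    ∑' k, a k * g k ≤ ∑' k, b k * g k := by
  obtain ⟨d, hd⟩ := exists_eq_sum_range_of_monotone hg
  simp_rw [hd, tsum_mul_sum_range]
  exact ENNReal.tsum_le_tsum fun m => mul_le_mul_right (hab m) _

lemma Majorizes.tsum_mul_le {P Q : Measure ℕ} [IsProbabilityMeasure P] [IsProbabilityMeasure Q]
    (h : Majorizes Q P) {g : ℕ → ℝ≥0∞} (hg : Monotone g) :
    ∑' k, decRearr Q k * g k ≤ ∑' k, decRearr P k * g k := by
  refine tsum_mul_le_tsum_mul_of_monotone hg fun m => ?_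
  have hP := ENNReal.summable.sum_add_tsum_nat_add' (f := decRearr P) (k := m)
  have hQ := ENNReal.summable.sum_add_tsum_nat_add' (f := decRearr Q) (k := m)
  rw [tsum_decRearr_eq_one] at hP hQ
  have hne : ∑ i ∈ Finset.range m, decRearr Q i ≠ ∞ :=
    ne_top_of_le_ne_top ENNReal.one_ne_top (hQ ▸ le_self_add)
  -- Both total masses are 1, so larger partial sums mean smaller tails.
  refine (ENNReal.add_le_add_iff_left hne).mp ?_
  rw [hQ, ← hP]
  exact add_le_add_left (h m) _

/-! ### Fano's inequality for list decoding under majorization -/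

/-- The part of the entropy of `P` carried by self-information in excess of `M`. -/
noncomputable def tailInfo (P : Measure ℕ) (M : ℝ≥0∞) : ℝ≥0∞ :=
  ∑' x, P {x} * (selfInfo (P {x}) - M)

lemma tendsto_tailInfo {P : Measure ℕ} [IsFiniteMeasure P] (hP : shannonEntropy P < ∞) :
    Tendsto (fun n : ℕ => tailInfo P n) atTop (𝓝 0) := by
  have hint : ∀ F : ℕ → ℝ≥0∞, ∑' x, P {x} * F x = ∫⁻ x, F x ∂P := fun F => by
    rw [lintegral_countable']
    exact tsum_congr fun x => mul_comm _ _
  rw [shannonEntropy_eq_tsum, hint] at hP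
  simp_rw [tailInfo, fun n : ℕ => hint fun x => selfInfo (P {x}) - n]
  have hlim := tendsto_lintegral_filter_of_dominated_convergence (μ := P) (l := atTop)
    (F := fun (n : ℕ) x => selfInfo (P {x}) - n) (f := fun _ => 0)
    (fun x => selfInfo (P {x})) (Eventually.of_forall fun n => measurable_of_countable _)
    (Eventually.of_forall fun n => Eventually.of_forall fun x => tsub_le_self) hP.ne ?_
  · simpa using hlim
  · filter_upwards [ae_lt_top (measurable_of_countable _) hP.ne] with x hx
    obtain ⟨N, hN⟩ := ENNReal.exists_nat_gt hx.ne
    refine tendsto_const_nhds.congr' ?_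
    filter_upwards [eventually_ge_atTop N] with n hn
    refine (tsub_eq_zero_of_le (hN.le.trans ?_)).symm
    exact_mod_cast hn

/-- The sub-distribution carrying the masses of `P` in the order in which `Q` ranks the letters. -/
noncomputable def rerank (P Q : Measure ℕ) (x : ℕ) : ℝ≥0∞ :=
  if Q {x} = 0 then 0 else decRearr P (massRank Q x)

section Rerank

variable {P Q : Measure ℕ} [IsProbabilityMeasure P] [IsProbabilityMeasure Q]

lemma tsum_rerank_le_one : ∑' x, rerank P Q x ≤ 1 := by
  let S : Set ℕ := {x | Q {x} ≠ 0}
  have h1 : ∑' x, rerank P Q x = ∑' x : S, rerank P Q x := by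
    refine (tsum_subtype_eq_of_support_subset (f := rerank P Q) (s := S) fun x hx hx0 => hx ?_).symm
    simp [rerank, hx0]
  have hinj : Function.Injective fun x : S => massRank Q x :=
    fun x y h => Subtype.ext (injOn_massRank x.2 y.2 h)
  rw [h1, ← tsum_decRearr_eq_one (P := P)]
  refine le_trans (le_of_eq ?_) (ENNReal.tsum_comp_le_tsum_of_injective hinj (decRearr P))
  exact tsum_congr fun x => if_neg x.2

lemma decRearr_ne_top (k : ℕ) : decRearr P k ≠ ∞ :=
  ne_top_of_le_ne_top ENNReal.one_ne_top
    (tsum_decRearr_eq_one (P := P) ▸ ENNReal.le_tsum (f := decRearr P) k)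

lemma Majorizes.tsum_selfInfo_rerank_le (h : Majorizes Q P) (M : ℝ≥0∞) :
    ∑' x, Q {x} * (selfInfo (rerank P Q x) - M) ≤ tailInfo P M := by
  have h1 : ∀ x, Q {x} * (selfInfo (rerank P Q x) - M)
      = Q {x} * (selfInfo (decRearr P (massRank Q x)) - M) := by
    intro x
    by_cases hx : Q {x} = 0
    · simp [hx]
    · simp [rerank, hx]
  simp_rw [h1]
  refine (tsum_mul_comp_massRank_le fun k => selfInfo (decRearr P k) - M).trans ?_
  refine (h.tsum_mul_le fun j k hjk => ?_).trans_eq ?_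
  · exact tsub_le_tsub_right (selfInfo_anti (decRearr_antitone P hjk) (decRearr_ne_top j)) M
  · exact tsum_decRearr (φ := fun t => t * (selfInfo t - M)) (by simp)

end Rerank

section Fano

lemma selfInfo_ofReal_exp_neg {η : ℝ} : selfInfo (ENNReal.ofReal (Real.exp (-η)))
    = ENNReal.ofReal η := by
  rw [selfInfo_of_ne_zero (by simpa using Real.exp_pos _),
    ENNReal.toReal_ofReal (Real.exp_pos _).le, Real.log_exp, neg_neg]

lemma selfInfo_natCast_inv (L : ℕ) :
    selfInfo (L : ℝ≥0∞)⁻¹ = ENNReal.ofReal (Real.log L) := by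
  rw [selfInfo_of_ne_zero (by simp), ENNReal.toReal_inv, Real.log_inv, neg_neg,
    ENNReal.toReal_natCast]

lemma selfInfo_ne_top {t : ℝ≥0∞} (ht : t ≠ 0) : selfInfo t ≠ ∞ := by
  rw [selfInfo_of_ne_zero ht]
  exact ENNReal.ofReal_ne_top

variable {Ω β : Type*} [MeasurableSpace Ω] [MeasurableSpace β]
  {X : Ω → ℕ} {Y : Ω → β} {μ : Measure Ω} [IsProbabilityMeasure μ]

/-- The reference kernel of the Fano argument: weight `exp (-η)` spread evenly over the list,
and the remaining weight distributed by `r`. -/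
noncomputable def fanoWeight {L : ℕ} (f : ListDecoder β L) (η : ℝ) (r : ℕ → ℝ≥0∞)
    (z : β × ℕ) : ℝ≥0∞ :=
  if z.2 ∈ f.toFun z.1 then ENNReal.ofReal (Real.exp (-η)) * (L : ℝ≥0∞)⁻¹
  else ENNReal.ofReal (1 - Real.exp (-η)) * r z.2

lemma measurable_fanoWeight {L : ℕ} (f : ListDecoder β L) (η : ℝ) (r : ℕ → ℝ≥0∞) :
    Measurable (fanoWeight f η r) :=
  measurable_from_prod_countable_left fun x =>
    Measurable.ite (f.measurableSet_mem x) measurable_const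
      (measurable_const (a := ENNReal.ofReal (1 - Real.exp (-η)) * r x))

lemma tsum_fanoWeight_le_one {L : ℕ} (hL : 1 ≤ L) (f : ListDecoder β L) {η : ℝ} (hη : 0 ≤ η)
    {r : ℕ → ℝ≥0∞} (hr : ∑' x, r x ≤ 1) (y : β) : ∑' x, fanoWeight f η r (y, x) ≤ 1 := by
  have hL0 : (L : ℝ≥0∞) ≠ 0 := by exact_mod_cast (by omega : L ≠ 0)
  set c := ENNReal.ofReal (Real.exp (-η)) with hc
  set d := ENNReal.ofReal (1 - Real.exp (-η)) with hd
  have hle : ∀ x, fanoWeight f η r (y, x)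
      ≤ (if x ∈ f.toFun y then c * (L : ℝ≥0∞)⁻¹ else 0) + d * r x := by
    intro x
    unfold fanoWeight
    split_ifs
    · exact le_self_add
    · exact le_add_self
  have hlist : ∑' x, (if x ∈ f.toFun y then c * (L : ℝ≥0∞)⁻¹ else 0) ≤ c := by
    rw [tsum_eq_sum (s := f.toFun y) fun x hx => if_neg hx,
      Finset.sum_congr rfl fun x hx => if_pos hx, Finset.sum_const, nsmul_eq_mul]
    calc ((f.toFun y).card : ℝ≥0∞) * (c * (L : ℝ≥0∞)⁻¹)
        ≤ L * (c * (L : ℝ≥0∞)⁻¹) := by gcongr; exact_mod_cast f.card_le y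
      _ = c * (L * (L : ℝ≥0∞)⁻¹) := by ring
      _ = c := by rw [ENNReal.mul_inv_cancel hL0 (ENNReal.natCast_ne_top L), mul_one]
  calc ∑' x, fanoWeight f η r (y, x)
      ≤ ∑' x, ((if x ∈ f.toFun y then c * (L : ℝ≥0∞)⁻¹ else 0) + d * r x) :=
        ENNReal.tsum_le_tsum hle
    _ = ∑' x, (if x ∈ f.toFun y then c * (L : ℝ≥0∞)⁻¹ else 0) + d * ∑' x, r x := by
        rw [ENNReal.tsum_add, ENNReal.tsum_mul_left]
    _ ≤ c + d * 1 := by gcongr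
    _ = 1 := by
        rw [mul_one, hc, hd, ← ENNReal.ofReal_add (Real.exp_pos _).le
          (by simpa using hη)]
        simp

lemma condShannonEntropy_le_of_listDecoder (hX : Measurable X) (hY : Measurable Y)
    {P : Measure ℕ} [IsProbabilityMeasure P] (hmaj : Majorizes (μ.map X) P) {L : ℕ} (hL : 1 ≤ L)
    {η : ℝ} (hη : 0 ≤ η) (M : ℝ≥0∞) (f : ListDecoder β L) :
    condShannonEntropy X Y μ ≤ ENNReal.ofReal (Real.log L) + ENNReal.ofReal η + tailInfo P M
      + μ {ω | X ω ∉ f.toFun (Y ω)} * (selfInfo (ENNReal.ofReal (1 - Real.exp (-η))) + M) := by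
  have := Measure.isProbabilityMeasure_map (μ := μ) hX.aemeasurable
  set r := rerank P (μ.map X)
  set C := selfInfo (ENNReal.ofReal (1 - Real.exp (-η))) + M with hC
  have hE : MeasurableSet {ω | X ω ∉ f.toFun (Y ω)} := by
    have : MeasurableSet {z : β × ℕ | z.2 ∈ f.toFun z.1} :=
      measurableSet_setOfPred.mpr (measurable_from_prod_countable_left fun x =>
        measurableSet_setOfPred.mp (f.measurableSet_mem x))
    exact ((hY.prodMk hX) this).compl
  have hpt : ∀ ω, selfInfo (fanoWeight f η r (Y ω, X ω))
      ≤ (ENNReal.ofReal (Real.log L) + ENNReal.ofReal η) + (selfInfo (r (X ω)) - M)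
        + Set.indicator {ω | X ω ∉ f.toFun (Y ω)} (fun _ => C) ω := by
    intro ω
    by_cases h : X ω ∈ f.toFun (Y ω)
    · rw [fanoWeight, if_pos h, Set.indicator_of_notMem (by simpa using h), add_zero]
      refine le_trans ((selfInfo_mul_le _ _).trans_eq ?_) le_self_add
      rw [selfInfo_ofReal_exp_neg, selfInfo_natCast_inv, add_comm]
    · rw [fanoWeight, if_neg h, Set.indicator_of_mem (by simpa using h)]
      refine (selfInfo_mul_le _ _).trans ?_
      -- Cutting at M leaves a bounded cost `C` on the error event; the excess is later integrated
      -- over the whole space.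
      calc _ ≤ selfInfo (ENNReal.ofReal (1 - Real.exp (-η))) + (selfInfo (r (X ω)) - M + M) := by
            gcongr
            exact le_tsub_add
        _ = (selfInfo (r (X ω)) - M) + C := by rw [hC]; ring
        _ ≤ _ := by gcongr; exact le_add_self
  refine (condShannonEntropy_le hX hY (measurable_fanoWeight f η r)
    (tsum_fanoWeight_le_one hL f hη tsum_rerank_le_one)).trans ?_
  refine (lintegral_mono hpt).trans ?_
  rw [lintegral_add_right _ (measurable_const.indicator hE), lintegral_add_left measurable_const,
    lintegral_const, measure_univ, mul_one, lintegral_indicator hE, setLIntegral_const,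
    lintegral_comp_eq_tsum hX fun x => selfInfo (r x) - M, mul_comm C]
  gcongr
  exact hmaj.tsum_selfInfo_rerank_le M

lemma condShannonEntropy_le_listError (hX : Measurable X) (hY : Measurable Y)
    {P : Measure ℕ} [IsProbabilityMeasure P] (hmaj : Majorizes (μ.map X) P) {L : ℕ} (hL : 1 ≤ L)
    {η : ℝ} (hη : 0 < η) {M : ℝ≥0∞} (hM : M ≠ ∞) (hM0 : M ≠ 0) :
    condShannonEntropy X Y μ ≤ ENNReal.ofReal (Real.log L) + ENNReal.ofReal η + tailInfo P M
      + listError L X Y μ * (selfInfo (ENNReal.ofReal (1 - Real.exp (-η))) + M) := by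
  have hd : ENNReal.ofReal (1 - Real.exp (-η)) ≠ 0 := by simpa using hη
  -- The infimum over decoders passes through the product because the factor is neither 0 (by `hM0`)
  -- nor ∞.
  rw [listError, ENNReal.iInf_mul_of_ne (by simp [hM0])
    (ENNReal.add_ne_top.mpr ⟨selfInfo_ne_top hd, hM⟩), ENNReal.add_iInf]
  exact le_iInf fun f => condShannonEntropy_le_of_listDecoder hX hY hmaj hL hη.le M f

end Fano

/-! ### The asymptotic statement -/

theorem theorem5 {Ω : Type*} [MeasurableSpace Ω] (μ : Measure Ω) [IsProbabilityMeasure μ]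
    {𝒴 : ℕ → Type*} [∀ i, MeasurableSpace (𝒴 i)]
    (X : ℕ → Ω → ℕ) (hX : ∀ i, Measurable (X i))
    (Y : (i : ℕ) → Ω → 𝒴 i) (hY : ∀ i, Measurable (Y i))
    (hHX : ∀ i, shannonEntropy (μ.map (X i)) < ∞)
    (L : ℕ → ℕ) (hL : ∀ n, 1 ≤ n → 1 ≤ L n)
    (P : Measure ℕ) [IsProbabilityMeasure P] (hHP : shannonEntropy P < ∞)
    (hmaj : ∀ᶠ i in atTop, Majorizes (μ.map (X i)) P)
    (herr : Tendsto (fun n => symbolwiseListError L X Y μ n) atTop (𝓝 0)) :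
    limsup (fun n : ℕ => condShannonEntropy (block X n) (block Y n) μ / (n : ℝ≥0∞)) atTop
      ≤ limsup (fun n : ℕ => ENNReal.ofReal (Real.log (L n))) atTop := by
  set ℓ := limsup (fun n : ℕ => ENNReal.ofReal (Real.log (L n))) atTop with hℓ
  refine ENNReal.le_of_forall_pos_le_add fun ε hε hℓtop => ?_
  -- Five losses of size `e`: the list weight, the tail of P, the slack in the limsup, the early
  -- letters, and the error term.
  set η : ℝ := (ε : ℝ) / 5 with hηdef
  have hη : 0 < η := by positivity
  set e := ENNReal.ofReal η with he
  have he0 : 0 < e := ENNReal.ofReal_pos.mpr hη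
  obtain ⟨M, hMtail, hM1⟩ := (((tendsto_tailInfo hHP).eventually (Iio_mem_nhds he0)).and
    (eventually_ge_atTop 1)).exists
  set C := selfInfo (ENNReal.ofReal (1 - Real.exp (-η))) + (M : ℝ≥0∞) with hC
  have hCtop : C ≠ ∞ := ENNReal.add_ne_top.mpr
    ⟨selfInfo_ne_top (by simpa using hη), ENNReal.natCast_ne_top M⟩
  obtain ⟨N, hN⟩ := eventually_atTop.mp hmaj
  set A := ∑ i ∈ Finset.range N, shannonEntropy (μ.map (X i)) with hA
  have hAtop : A ≠ ∞ := ENNReal.sum_ne_top.mpr fun i _ => (hHX i).ne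
  have hAlim : Tendsto (fun n : ℕ => A / (n : ℝ≥0∞)) atTop (𝓝 0) := by
    have := ENNReal.Tendsto.const_mul (a := A) ENNReal.tendsto_inv_nat_nhds_zero (Or.inr hAtop)
    simpa [div_eq_mul_inv] using this
  have hElim : Tendsto (fun n : ℕ => symbolwiseListError L X Y μ n * C) atTop (𝓝 0) := by
    have := ENNReal.Tendsto.mul_const (b := C) herr (Or.inr hCtop)
    simpa using this
  have hLlim : ∀ᶠ n : ℕ in atTop, ENNReal.ofReal (Real.log (L n)) < ℓ + e :=
    eventually_lt_of_limsup_lt (ENNReal.lt_add_right hℓtop.ne he0.ne')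
  refine limsup_le_of_le (by isBoundedDefault) ?_
  filter_upwards [hAlim.eventually (Iio_mem_nhds he0), hElim.eventually (Iio_mem_nhds he0), hLlim,
    eventually_ge_atTop 1] with n hn1 hn2 hn3 hn
  have hn0 : (n : ℝ≥0∞) ≠ 0 := by exact_mod_cast (by omega : n ≠ 0)
  -- Letters before `N` are charged their full entropy, whose total `A` does not depend on n.
  have hletter : ∀ i, condShannonEntropy (X i) (Y i) μ
      ≤ (if i < N then shannonEntropy (μ.map (X i)) else 0)
        + ((ℓ + e + e + e) + listError (L n) (X i) (Y i) μ * C) := by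
    intro i
    split_ifs with hi
    · exact (condShannonEntropy_le_shannonEntropy (hX i) (hY i)).trans le_self_add
    · rw [zero_add]
      refine (condShannonEntropy_le_listError (hX i) (hY i) (hN i (by omega)) (hL n hn) hη
        (ENNReal.natCast_ne_top M) (by exact_mod_cast (by omega : M ≠ 0))).trans ?_
      gcongr
  have hfirst : ∑ i ∈ Finset.range n, (if i < N then shannonEntropy (μ.map (X i)) else 0) ≤ A := by
    rw [← Finset.sum_filter]
    refine Finset.sum_le_sum_of_subset fun i hi => ?_
    simpa using (Finset.mem_filter.mp hi).2
  have hsum : condShannonEntropy (block X n) (block Y n) μ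
      ≤ A + (n * (ℓ + e + e + e)
        + (∑ i ∈ Finset.range n, listError (L n) (X i) (Y i) μ) * C) := by
    refine (condShannonEntropy_block_le_sum hX hY n).trans ?_
    refine (Finset.sum_le_sum fun i _ => hletter i).trans ?_
    rw [Finset.sum_add_distrib, Finset.sum_add_distrib, Finset.sum_const, Finset.card_range,
      nsmul_eq_mul, Finset.sum_mul]
    gcongr
  calc condShannonEntropy (block X n) (block Y n) μ / (n : ℝ≥0∞)
      ≤ (A + (n * (ℓ + e + e + e)
        + (∑ i ∈ Finset.range n, listError (L n) (X i) (Y i) μ) * C)) / n := by gcongr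
    _ = A / n + ((ℓ + e + e + e) + symbolwiseListError L X Y μ n * C) := by
        rw [ENNReal.add_div, ENNReal.add_div, symbolwiseListError,
          mul_comm (n : ℝ≥0∞), ENNReal.mul_div_cancel_right hn0 (ENNReal.natCast_ne_top n),
          ENNReal.mul_div_right_comm]
    _ ≤ e + ((ℓ + e + e + e) + e) := by gcongr
    _ = ℓ + 5 * e := by ring
    _ = ℓ + ε := by
        congr 1
        rw [he, hηdef, ← ENNReal.ofReal_ofNat, ← ENNReal.ofReal_mul (by norm_num),
          mul_div_cancel₀ _ (by norm_num), ENNReal.ofReal_coe_nnreal]
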